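/- All graphs are finite and simple. For a digraph $D$ let $d_D(a,b)$ be the length of a shortest directed path from $a$ to $b$ ($\infty$ if there is none), and let $d(D)=\max_{a,b}d_D(a,b)$; an orientation $D$ of a graph (a choice of exactly one direction for each edge) is strong if $d_D(a,b)<\infty$ for all vertices $a,b$. The orientation number $\bar d(X)$ of a graph $X$ is the minimum of $d(D)$ over all strong orientations $D$ of $X$ ($\infty$ if there are none). For a connected graph $G$ with vertices $v_1,\dots,v_n$ and diameter $d(G)$, and for positive integers $s_1,\dots,s_n$, the vertex-multiplication $G(s_1,\dots,s_n)$ is the graph whose vertex set is a disjoint union of sets $V_1,\dots,V_n$ with $|V_i|=s_i$, where $a\in V_i$ and $b\in V_j$ are adjacent if and only if $v_iv_j\in E(G)$. If all $s_i\ge 2$, write $G(s_1,\dots,s_n)\in\mathscr C_0$ if $\bar d(G(s_1,\dots,s_n))=d(G)$. Theorem 1.7. Let $\lambda\ge 2$ and $\mu\ge 3$ be integers, let $T_\lambda$ and $T_\mu$ be trees of diameters $\lambda$ and $\mu$, and let $T_\lambda\times T_\mu$ be their Cartesian product, with $n$ vertices. Then for all integers $s_1,\dots,s_n\ge 2$,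 $$(T_\lambda\times T_\mu)(s_1,\dots,s_n)\in\mathscr C_0,$$ and, explicitly, $\bar d\big((T_\lambda\times T_\mu)(s_1,\dots,s_n)\big)=\lambda+\mu$. -/

import Mathlib

namespace OrientNum

universe u

/-- `HasWalk D n a b`: the digraph `D` has a directed walk of length `n` from `a` to `b`. -/
inductive HasWalk {V : Type u} (D : Digraph V) : ℕ → V → V → Prop
  | nil (a : V) : HasWalk D 0 a a
  | cons {n : ℕ} {a b c : V} (h : D.Adj a b) (w : HasWalk D n b c) : HasWalk D (n + 1) a c

/-- The directed distance from `a` to `b`: the length of a shortest directed walk (equivalently,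
of a shortest directed path) from `a` to `b`, and `⊤` if there is none. -/
noncomputable def dist {V : Type u} (D : Digraph V) (a b : V) : ℕ∞ :=
  ⨅ (n : ℕ) (_ : HasWalk D n a b), (n : ℕ∞)

/-- The diameter of a digraph: the largest directed distance between two of its vertices. -/
noncomputable def diam {V : Type u} (D : Digraph V) : ℕ∞ :=
  ⨆ (a : V) (b : V), dist D a b

/-- A digraph is strong if every two vertices are mutually reachable. -/
def IsStrong {V : Type u} (D : Digraph V) : Prop :=
  ∀ a b : V, dist D a b < ⊤

/-- `D` is an orientation of `G`: it arises by giving each edge of `G` exactly one direction. -/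
structure IsOrientation {V : Type u} (G : SimpleGraph V) (D : Digraph V) : Prop where
  adj_iff : ∀ a b : V, G.Adj a b ↔ D.Adj a b ∨ D.Adj b a
  asymm : ∀ a b : V, D.Adj a b → ¬ D.Adj b a

/-- The orientation number of `G`: the least diameter of a strong orientation of `G`.
The infimum of a nonempty set in `ℕ∞` is attained; the value is `⊤` if there is no strong
orientation. -/
noncomputable def orientationNumber {V : Type u} (G : SimpleGraph V) : ℕ∞ :=
  sInf {d : ℕ∞ | ∃ D : Digraph V, IsOrientation G D ∧ IsStrong D ∧ diam D = d}

/-- The `G` vertex-multiplication with multiplicities `s`: each vertex `v` is replaced by `s v`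
copies, and copies of `v` and `w` are adjacent iff `v` and `w` are adjacent in `G`. -/
def vertexMul {V : Type u} (G : SimpleGraph V) (s : V → ℕ) : SimpleGraph (Σ v : V, Fin (s v)) where
  Adj a b := G.Adj a.1 b.1
  symm := ⟨fun _ _ h => SimpleGraph.Adj.symm h⟩
  loopless := ⟨fun _ h => G.irrefl h⟩

/-- The vertex-multiplication of the connected graph `G` with multiplicities `s`, all at least `2`,
lies in the class `𝒞_j`: its orientation number exceeds the diameter of `G` by exactly `j`. -/
def InClass {V : Type u} (j : ℕ) (G : SimpleGraph V) (s : V → ℕ) : Prop :=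
  G.Connected ∧ (∀ v, 2 ≤ s v) ∧ orientationNumber (vertexMul G s) = G.ediam + (j : ℕ∞)

end OrientNum

namespace OrientNum

open SimpleGraph

section Distance

variable {V : Type*}

/-! Directed walks project to walks of the same length in the base graph, so no orientation has
diameter below that of the product. For the upper bound, split the copies of each vertex into two
nonempty classes and orient edges by a `ZMod 2` voltage `σ` with `σ u v + σ v u = 1`. Nonempty walks
lift to every pair of end copies whose class difference is their voltage (`hasWalk_of_walkVoltage`),
so two short walks of different voltages suffice. If both coordinates differ, geodesics going the
two ways around a first square do this (`exists_geodesics_walkVoltage_ne`). Otherwise the distance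
is at least two below the bound, which pays for an edge traversed back and forth, a detour of
voltage `1`. -/

lemma dist_le_of_hasWalk {D : Digraph V} {n : ℕ} {a b : V} (h : HasWalk D n a b) :
    dist D a b ≤ n :=
  iInf₂_le n h

lemma edist_fst_le_of_hasWalk {G : SimpleGraph V} {s : V → ℕ} {D : Digraph (Σ v, Fin (s v))}
    (hD : IsOrientation (vertexMul G s) D) {n : ℕ} {a b : Σ v, Fin (s v)}
    (h : HasWalk D n a b) : G.edist a.1 b.1 ≤ n := by
  suffices ∃ p : G.Walk a.1 b.1, p.length = n by
    obtain ⟨p, rfl⟩ := this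
    exact edist_le p
  induction h with
  | nil a => exact ⟨Walk.nil, rfl⟩
  | cons h _ ih =>
    obtain ⟨p, hp⟩ := ih
    have hadj : G.Adj _ _ := (hD.adj_iff _ _).2 (Or.inl h)
    exact ⟨Walk.cons hadj p, by rw [Walk.length_cons, hp]⟩

lemma ediam_le_diam {G : SimpleGraph V} {s : V → ℕ} (hs : ∀ v, 0 < s v)
    {D : Digraph (Σ v, Fin (s v))} (hD : IsOrientation (vertexMul G s) D) :
    G.ediam ≤ diam D := by
  refine ediam_le_of_edist_le fun u v => ?_
  refine le_trans ?_ (le_iSup₂ (f := fun a b => dist D a b) ⟨u, 0, hs u⟩ ⟨v, 0, hs v⟩)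
  exact le_iInf₂ fun n h => edist_fst_le_of_hasWalk hD h

lemma ediam_le_orientationNumber (G : SimpleGraph V) {s : V → ℕ} (hs : ∀ v, 0 < s v) :
    G.ediam ≤ orientationNumber (vertexMul G s) := by
  refine le_sInf ?_
  rintro _ ⟨D, hD, -, rfl⟩
  exact ediam_le_diam hs hD

lemma orientationNumber_le {G : SimpleGraph V} {D : Digraph V} (hD : IsOrientation G D) {n : ℕ}
    (h : ∀ a b, dist D a b ≤ n) : orientationNumber G ≤ n :=
  le_trans (sInf_le ⟨D, hD, fun a b => (h a b).trans_lt (ENat.natCast_lt_top n), rfl⟩) (iSup₂_le h)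

end Distance

section Voltage

variable {V : Type*} {G : SimpleGraph V} {s : V → ℕ} (σ : V → V → ZMod 2)

/-- The class in `ZMod 2` of a copy of a vertex: the first copy has class `0`, all others have
class `1`. -/
def copyClass {n : ℕ} (i : Fin n) : ZMod 2 := if i.val = 0 then 0 else 1

lemma exists_copyClass_eq {n : ℕ} (hn : 2 ≤ n) (c : ZMod 2) :
    ∃ i : Fin n, copyClass i = c := by
  have hc : c = 0 ∨ c = 1 := by revert c; decide
  rcases hc with rfl | rfl
  · exact ⟨⟨0, by omega⟩, by simp [copyClass]⟩
  · exact ⟨⟨1, by omega⟩, by simp [copyClass]⟩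

/-- The digraph on the copies of the vertices of `G` in which a copy of `v` points to those copies
of a neighbour `w` whose class differs from its own by the voltage `σ v w`. -/
def voltageDigraph (G : SimpleGraph V) (s : V → ℕ) (σ : V → V → ZMod 2) :
    Digraph (Σ v, Fin (s v)) where
  Adj a b := G.Adj a.1 b.1 ∧ copyClass b.2 = copyClass a.2 + σ a.1 b.1

/-- The total voltage along a walk. -/
def walkVoltage : {u v : V} → G.Walk u v → ZMod 2
  | _, _, .nil => 0
  | _, _, .cons (u := u) (v := v) _ p => σ u v + walkVoltage p

@[simp] lemma walkVoltage_nil (u : V) : walkVoltage σ (Walk.nil : G.Walk u u) = 0 := rfl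

@[simp] lemma walkVoltage_cons {u v w : V} (h : G.Adj u v) (p : G.Walk v w) :
    walkVoltage σ (Walk.cons h p) = σ u v + walkVoltage σ p := rfl

variable {σ}

lemma isOrientation_voltageDigraph (hσ : ∀ u v, G.Adj u v → σ u v + σ v u = 1) :
    IsOrientation (vertexMul G s) (voltageDigraph G s σ) where
  adj_iff a b := by
    have key : ∀ x y p q : ZMod 2, p + q = 1 → (y = x + p ∨ x = y + q) := by decide
    constructor
    · intro h
      exact (key _ _ _ _ (hσ _ _ h)).imp (fun h' => ⟨h, h'⟩) (fun h' => ⟨SimpleGraph.Adj.symm h, h'⟩)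
    · rintro (h | h)
      · exact h.1
      · exact SimpleGraph.Adj.symm h.1
  asymm a b h h' := by
    have key : ∀ x y p q : ZMod 2, p + q = 1 → y = x + p → x ≠ y + q := by decide
    exact key _ _ _ _ (hσ _ _ h.1) h.2 h'.2

/-- Since `2 ≤ s v`, both classes occur over each inner vertex, so the lift never gets stuck, and
its last step may choose any copy of the right class. The empty walk has no such step: equal classes
do not give equal copies. -/
lemma hasWalk_of_walkVoltage (hs : ∀ v, 2 ≤ s v) {u v : V} (p : G.Walk u v) (hp : ¬ p.Nil)
    (i : Fin (s u)) (j : Fin (s v)) (h : copyClass j = copyClass i + walkVoltage σ p) :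
    HasWalk (voltageDigraph G s σ) p.length ⟨u, i⟩ ⟨v, j⟩ := by
  induction p with
  | nil => simp at hp
  | cons hadj q ih =>
    rename_i u w v
    by_cases hq : q.Nil
    · cases q with
      | nil => exact .cons ⟨hadj, by simpa using h⟩ (.nil _)
      | cons _ _ => simp at hq
    · obtain ⟨k, hk⟩ := exists_copyClass_eq (hs w) (copyClass i + σ u w)
      refine .cons (b := ⟨w, k⟩) ⟨hadj, hk⟩ (ih hq k j ?_)
      rw [h, hk, walkVoltage_cons, add_assoc]

/-- Two walks of different voltages reach all copies of their common end. -/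
lemma dist_le_of_walkVoltage_ne (hs : ∀ v, 2 ≤ s v) {u v : V} {n : ℕ} (p q : G.Walk u v)
    (hp : ¬ p.Nil) (hq : ¬ q.Nil) (hpn : p.length ≤ n) (hqn : q.length ≤ n)
    (hpq : walkVoltage σ p ≠ walkVoltage σ q) (i : Fin (s u)) (j : Fin (s v)) :
    dist (voltageDigraph G s σ) ⟨u, i⟩ ⟨v, j⟩ ≤ n := by
  have key : ∀ x y c d : ZMod 2, c ≠ d → y = x + c ∨ y = x + d := by decide
  rcases key (copyClass i) (copyClass j) _ _ hpq with h | h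
  · exact (dist_le_of_hasWalk (hasWalk_of_walkVoltage hs p hp i j h)).trans (mod_cast hpn)
  · exact (dist_le_of_hasWalk (hasWalk_of_walkVoltage hs q hq i j h)).trans (mod_cast hqn)

/-- Moving along an edge and back changes the class of the copy, at the cost of two steps. -/
lemma dist_le_of_length_add_two_le (hs : ∀ v, 2 ≤ s v)
    (hσ : ∀ u v, G.Adj u v → σ u v + σ v u = 1) {u v w : V} (huw : G.Adj u w) (p : G.Walk u v)
    {n : ℕ} (hn4 : 4 ≤ n) (hn : p.length + 2 ≤ n) (i : Fin (s u)) (j : Fin (s v)) :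
    dist (voltageDigraph G s σ) ⟨u, i⟩ ⟨v, j⟩ ≤ n := by
  let q := Walk.cons huw (Walk.cons huw.symm p)
  have hqv : walkVoltage σ q = walkVoltage σ p + 1 := by
    simp only [q, walkVoltage_cons, ← hσ u w huw]
    ring
  have hqn : q.length ≤ n := by simp only [q, Walk.length_cons]; omega
  by_cases hp : p.Nil
  · cases p with
    | nil =>
      by_cases hij : i = j
      · subst hij
        exact (dist_le_of_hasWalk (.nil _)).trans (by simp)
      -- Distinct copies of one vertex: the empty walk does not lift, so compare closed walks of
      -- lengths 2 and 4; hence `4 ≤ n`.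
      · let r := Walk.cons huw (Walk.cons huw.symm q)
        refine dist_le_of_walkVoltage_ne hs q r (by simp [q]) (by simp [r]) hqn
          (by simpa [r, q] using hn4) ?_ i j
        have key : ∀ x y c : ZMod 2, x + y = 1 → c ≠ x + (y + c) := by decide
        exact key _ _ _ (hσ u w huw)
    | cons _ _ => simp at hp
  · refine dist_le_of_walkVoltage_ne hs p q hp (by simp [q]) (by omega) hqn ?_ i j
    rw [hqv]
    have key : ∀ c : ZMod 2, c ≠ c + 1 := by decide
    exact key _

end Voltage

section Product

variable {V W : Type*} {T₁ : SimpleGraph V} {T₂ : SimpleGraph W}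

lemma length_boxProdLeft_append_boxProdRight {a c : V} {b d : W} (p : T₁.Walk a c)
    (q : T₂.Walk b d) :
    ((p.boxProdLeft T₂ b).append (q.boxProdRight T₁ c)).length = p.length + q.length :=
  (Walk.length_append _ _).trans (congrArg₂ _ (Walk.length_map _ _) (Walk.length_map _ _))

lemma add_eq_one_of_ne {c d : ZMod 2} (h : c ≠ d) : c + d = 1 := by
  revert c d
  decide

/-- A voltage assignment on the product of two properly `2`-coloured graphs for which the two ways
around any square differ. -/
noncomputable def productVoltage (C₁ : T₁.Coloring (ZMod 2)) (C₂ : T₂.Coloring (ZMod 2)) (x y : V × W) : ZMod 2 :=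
  open Classical in
  if x.2 = y.2 then C₁ x.1 + C₂ x.2 else C₂ x.2

variable (C₁ : T₁.Coloring (ZMod 2)) (C₂ : T₂.Coloring (ZMod 2))

lemma productVoltage_add_swap {x y : V × W} (h : (T₁ □ T₂).Adj x y) :
    productVoltage C₁ C₂ x y + productVoltage C₁ C₂ y x = 1 := by
  obtain ⟨a, b⟩ := x
  obtain ⟨c, d⟩ := y
  rcases boxProd_adj.1 h with ⟨h, e⟩ | ⟨h, e⟩
  · obtain rfl : b = d := e
    have := add_eq_one_of_ne (C₁.valid h)
    have key : ∀ x y z : ZMod 2, x + y = 1 → x + z + (y + z) = 1 := by decide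
    simpa [productVoltage] using key _ _ _ this
  · have hne : b ≠ d := h.ne
    simpa [productVoltage, hne, hne.symm] using add_eq_one_of_ne (C₂.valid h)

/-- Two vertices of the product which differ in both coordinates are joined by two geodesics of
different voltages. -/
lemma exists_geodesics_walkVoltage_ne (h₁ : T₁.Connected) (h₂ : T₂.Connected) {x y : V × W}
    (hx : x.1 ≠ y.1) (hy : x.2 ≠ y.2) :
    ∃ p q : (T₁ □ T₂).Walk x y,
      p.length = T₁.dist x.1 y.1 + T₂.dist x.2 y.2 ∧
      q.length = T₁.dist x.1 y.1 + T₂.dist x.2 y.2 ∧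
      walkVoltage (productVoltage C₁ C₂) p ≠ walkVoltage (productVoltage C₁ C₂) q := by
  obtain ⟨a, b⟩ := x
  obtain ⟨c, d⟩ := y
  obtain ⟨p₁, hp₁⟩ := h₁.exists_walk_length_eq_dist a c
  obtain ⟨p₂, hp₂⟩ := h₂.exists_walk_length_eq_dist b d
  simp only at hx hy ⊢
  rw [← hp₁, ← hp₂]
  clear hp₁ hp₂
  cases p₁ with
  | nil => exact absurd rfl hx
  | @cons _ a' _ e₁ r₁ =>
  cases p₂ with
  | nil => exact absurd rfl hy
  | @cons _ b' _ e₂ r₂ =>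
  let r : (T₁ □ T₂).Walk (a', b') (c, d) := (r₁.boxProdLeft T₂ b').append (r₂.boxProdRight T₁ c)
  have hr : r.length = r₁.length + r₂.length :=
    length_boxProdLeft_append_boxProdRight r₁ r₂
  refine ⟨.cons (v := (a', b)) (boxProd_adj_left.2 e₁) (.cons (boxProd_adj_right.2 e₂) r),
    .cons (v := (a, b')) (boxProd_adj_right.2 e₂) (.cons (boxProd_adj_left.2 e₁) r), ?_, ?_, ?_⟩
  · simp only [Walk.length_cons, hr]; omega
  · simp only [Walk.length_cons, hr]; omega
  -- The `T₂`-edge has voltage `C₂ b` on both routes, while the `T₁`-edge changes from `C₁ a + C₂ b`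
  -- to `C₁ a + C₂ b'`.
  · have hne : b ≠ b' := e₂.ne
    have := add_eq_one_of_ne (C₂.valid e₂)
    have key : ∀ x y z t : ZMod 2, y + z = 1 → x + y + (y + t) ≠ y + (x + z + t) := by decide
    simpa [productVoltage, hne] using key _ _ _ _ this

/-- The orientation number of a vertex-multiplication of a product of two bipartite graphs of
diameter at least two is at most the diameter of the product. -/
lemma orientationNumber_vertexMul_boxProd_le (C₁ : T₁.Coloring (ZMod 2))
    (C₂ : T₂.Coloring (ZMod 2)) (h₁ : T₁.Connected) (h₂ : T₂.Connected)
    (he₁ : T₁.ediam ≠ ⊤) (he₂ : T₂.ediam ≠ ⊤)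
    (hl : 2 ≤ T₁.diam) (hm : 2 ≤ T₂.diam) {s : V × W → ℕ} (hs : ∀ p, 2 ≤ s p) :
    orientationNumber (vertexMul (T₁ □ T₂) s) ≤ ((T₁.diam + T₂.diam : ℕ) : ℕ∞) := by
  have hσ : ∀ x y, (T₁ □ T₂).Adj x y → productVoltage C₁ C₂ x y + productVoltage C₁ C₂ y x = 1 :=
    fun x y => productVoltage_add_swap C₁ C₂
  refine orientationNumber_le (isOrientation_voltageDigraph hσ) ?_
  rintro ⟨⟨a, b⟩, i⟩ ⟨⟨c, d⟩, j⟩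
  have hac : T₁.dist a c ≤ T₁.diam := dist_le_diam he₁
  have hbd : T₂.dist b d ≤ T₂.diam := dist_le_diam he₂
  by_cases hne : a ≠ c ∧ b ≠ d
  · obtain ⟨p, q, hp, hq, hpq⟩ := exists_geodesics_walkVoltage_ne C₁ C₂ h₁ h₂
      (x := (a, b)) (y := (c, d)) hne.1 hne.2
    refine dist_le_of_walkVoltage_ne hs p q (fun h => hne.1 (congrArg Prod.fst h.eq))
      (fun h => hne.1 (congrArg Prod.fst h.eq)) ?_ ?_ hpq i j <;> simp only at hp hq <;> omega
  · have : Nontrivial V := nontrivial_of_diam_ne_zero (G := T₁) (by omega)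
    obtain ⟨a', ha'⟩ := h₁.preconnected.exists_adj_of_nontrivial a
    obtain ⟨p₁, hp₁⟩ := h₁.exists_walk_length_eq_dist a c
    obtain ⟨p₂, hp₂⟩ := h₂.exists_walk_length_eq_dist b d
    refine dist_le_of_length_add_two_le hs hσ (w := (a', b)) (boxProd_adj_left.2 ha')
      ((p₁.boxProdLeft T₂ b).append (p₂.boxProdRight T₁ c)) (by omega) ?_ i j
    rw [length_boxProdLeft_append_boxProdRight, hp₁, hp₂]
    -- The factor whose coordinates agree contributes distance `0`, and its diameter, at least `2`,
    -- absorbs the detour.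
    by_cases h : a = c
    · subst h
      rw [SimpleGraph.dist_self]
      omega
    · obtain rfl : b = d := by tauto
      rw [SimpleGraph.dist_self]
      omega

lemma ediam_boxProd [Finite V] [Finite W] [Nonempty V] [Nonempty W] :
    (T₁ □ T₂).ediam = T₁.ediam + T₂.ediam := by
  refine le_antisymm (ediam_le_of_edist_le fun x y => ?_) ?_
  · rw [edist_boxProd]
    exact add_le_add edist_le_ediam edist_le_ediam
  · obtain ⟨a, c, h⟩ := T₁.exists_edist_eq_ediam_of_finite
    obtain ⟨b, d, h'⟩ := T₂.exists_edist_eq_ediam_of_finite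
    rw [← h, ← h', ← edist_boxProd (a, b) (c, d)]
    exact edist_le_ediam

end Product

end OrientNum

open OrientNum in
theorem theorem1p7 {V W : Type*} [Finite V] [Finite W]
    (T₁ : SimpleGraph V) (T₂ : SimpleGraph W) (hT₁ : T₁.IsTree) (hT₂ : T₂.IsTree)
    (l m : ℕ) (hl : T₁.diam = l) (hm : T₂.diam = m) (hl2 : 2 ≤ l) (hm3 : 3 ≤ m)
    (s : V × W → ℕ) (hs : ∀ p, 2 ≤ s p) :
    OrientNum.InClass 0 (T₁.boxProd T₂) s ∧
      OrientNum.orientationNumber (OrientNum.vertexMul (T₁.boxProd T₂) s) =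
        (l : ℕ∞) + (m : ℕ∞) := by
  have := hT₁.connected.nonempty
  have := hT₂.connected.nonempty
  have he₁ := SimpleGraph.connected_iff_ediam_ne_top.1 hT₁.connected
  have he₂ := SimpleGraph.connected_iff_ediam_ne_top.1 hT₂.connected
  have hediam : (T₁.boxProd T₂).ediam = (l : ℕ∞) + (m : ℕ∞) := by
    rw [ediam_boxProd, ← hl, ← hm, SimpleGraph.diam, SimpleGraph.diam, ENat.natCast_toNat he₁,
      ENat.natCast_toNat he₂]
  obtain ⟨C₁⟩ := hT₁.isBipartite
  obtain ⟨C₂⟩ := hT₂.isBipartite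
  have hle := orientationNumber_vertexMul_boxProd_le C₁ C₂ hT₁.connected
    hT₂.connected he₁ he₂ (by omega) (by omega) hs
  rw [hl, hm, Nat.cast_add] at hle
  have hge := ediam_le_orientationNumber (T₁.boxProd T₂) (s := s) fun p => by have := hs p; omega
  rw [hediam] at hge
  have heq := le_antisymm hle hge
  exact ⟨⟨hT₁.connected.boxProd hT₂.connected, hs, by rw [heq, hediam]; simp⟩, heq⟩
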